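/- **Notation.** Let $\mathbb{H}^+=\{x+\mathrm{i}y : x\ge 0,\ y\in\mathbb{R}\}$ be the closed right half-plane, identified with a half-plane in $\mathbb{R}^3$ via $x+\mathrm{i}y\mapsto(x,y,0)$, and let $\mathbf{R}_\phi$ be the rotation of $\mathbb{R}^3$ by the angle $\phi$ about the $y$-axis. For $s>0$ and $z,w\in\mathbb{H}^+$ put $$\mathcal{K}_s(z,w)=\frac1{2\pi}\int_0^{2\pi}\frac{d\phi}{|\mathbf{R}_\phi z-w|^s}.$$ Let $w_*=-\overline{w}$. For $0<s<2$, $s\neq1$, let $$\mathcal{I}_s=\mathcal{I}_s\left(\mathbb{S}^1;\tfrac{d\phi}{2\pi}\right)=2^{-s}\,\frac{\Gamma((1-s)/2)}{\sqrt\pi\,\Gamma(1-s/2)}.$$ For $R>0$ let $\mathcal{K}_s^{(R)}(z,w)=2R\,[\mathcal{K}_s(R+z,R+w)-\mathcal{I}_s R^{-s}]$ if $0<s<1$ and $\mathcal{K}_s^{(R)}(z,w)=2R\,\mathcal{K}_s(R+z,R+w)$ if $s>1$, and let $$\mathcal{K}_s^{(\infty)}(z,w)=-\frac{2}{1-s}\,\frac{\Gamma((1+s)/2)}{\sqrt\pi\,\Gamma(s/2)}\,|z-w|^{1-s}.$$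 **Lemma 4.1.** (a) Let $0<s<2$, $s\ne1$, and let $z,w\in\mathbb{H}^+$, with $z\neq w$ if $s>1$. Then, as $R\to\infty$, $$\begin{aligned}\mathcal{K}_s(R+z,R+w)={}&\mathcal{I}_s R^{-s}-\frac{s}{1-s}\,\frac{\Gamma((1+s)/2)}{\sqrt\pi\,\Gamma(1+s/2)}\,\frac{|z-w|^{1-s}}{2R}\\&-2^{-s}\,\frac{s\,\Gamma((1-s)/2)}{\sqrt\pi\,\Gamma(1-s/2)}\,\frac{\mathrm{Re}[z-w_*]}{2R}\,R^{-s}+\mathcal{O}\left(\frac{s}{R^2}\right).\end{aligned}$$ Here the $\mathcal{O}$-term is uniform in $s$ away from $1$: for all $z,w\in\mathbb{H}^+$ and $\delta>0$ there are $C$ and $R_0>0$ such that for all admissible $s$ (that is, $0<s<2$, $s\ne1$, and $s<1$ if $z=w$) with $|s-1|\ge\delta$ and for all $R\ge R_0$ the error is at most $C\,s/R^2$ in absolute value. (b) For $0<s<1$, $\mathcal{K}_s^{(R)}\to\mathcal{K}_s^{(\infty)}$ as $R\to\infty$, uniformly on every compact subset of $\mathbb{H}^+\times\mathbb{H}^+$.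 (c) For $s>1$ and every compact $A\subset\mathbb{H}^+\times\mathbb{H}^+$, $|z-w|^{s-1}\mathcal{K}_s^{(R)}(z,w)\to|z-w|^{s-1}\mathcal{K}_s^{(\infty)}(z,w)$ as $R\to\infty$, uniformly in $(z,w)\in A$ with $z\ne w$; in particular $\mathcal{K}_s^{(R)}(z,w)\to\mathcal{K}_s^{(\infty)}(z,w)$ whenever $z\neq w$. -/

import Mathlib

/-- The closed right half-plane `{x + iy | x ≥ 0}`. -/
def closedRightHalfPlane : Set ℂ := {z | 0 ≤ z.re}

/-- The reflection `w_* = -conj w` of `w` in the imaginary axis. -/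
noncomputable def reflectIm (w : ℂ) : ℂ := -(starRingEnd ℂ) w

/-- The point `x + iy` of the reference plane, as the point `(x, y, 0)` of Euclidean 3-space.
The axis of revolution is the `y`-axis. -/
noncomputable def planeToSpace (z : ℂ) : EuclideanSpace ℝ (Fin 3) := !₂[z.re, z.im, 0]

/-- Rotation of Euclidean 3-space by the angle `φ` about the `y`-axis. -/
noncomputable def rotateY (φ : ℝ) (p : EuclideanSpace ℝ (Fin 3)) : EuclideanSpace ℝ (Fin 3) :=
  !₂[Real.cos φ * p 0 + Real.sin φ * p 2, p 1, -(Real.sin φ * p 0) + Real.cos φ * p 2]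

/-- The reduced kernel `K_s(z, w) = (1 / 2π) ∫_0^{2π} |R_φ z - w|^{-s} dφ`. -/
noncomputable def rieszKernel (s : ℝ) (z w : ℂ) : ℝ :=
  1 / (2 * Real.pi) *
    ∫ φ in (0 : ℝ)..(2 * Real.pi), 1 / ‖rotateY φ (planeToSpace z) - planeToSpace w‖ ^ s

/-- The constant `I_s(S¹; dφ/2π) = 2^{-s} Γ((1-s)/2) / (√π Γ(1 - s/2))`, for `0 < s < 2`, `s ≠ 1`.
For `0 < s < 1` it is the Riesz `s`-energy of the uniform measure on the unit circle; for
`1 < s < 2`, where that energy is infinite, the symbol stands for this expression. -/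
noncomputable def circleEnergy (s : ℝ) : ℝ :=
  (2 : ℝ) ^ (-s) * (Real.Gamma ((1 - s) / 2) / (Real.sqrt Real.pi * Real.Gamma (1 - s / 2)))

/-- The rescaled kernel `K_s^{(R)}`: it is `2R [K_s(R+z, R+w) - I_s(S¹; dφ/2π) R^{-s}]` for
`0 < s < 1` and `2R K_s(R+z, R+w)` for `s > 1` (it is not used for `s = 1`). -/
noncomputable def rescaledKernel (s R : ℝ) (z w : ℂ) : ℝ :=
  if s < 1 then 2 * R * (rieszKernel s ((R : ℂ) + z) ((R : ℂ) + w) - circleEnergy s * R ^ (-s))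
  else 2 * R * rieszKernel s ((R : ℂ) + z) ((R : ℂ) + w)

/-- The limit kernel `K_s^{(∞)}(z, w) = -(2/(1-s)) Γ((1+s)/2) / (√π Γ(s/2)) |z - w|^{1-s}`. -/
noncomputable def limitKernel (s : ℝ) (z w : ℂ) : ℝ :=
  -(2 / (1 - s)) * (Real.Gamma ((1 + s) / 2) / (Real.sqrt Real.pi * Real.Gamma (s / 2))) *
    ‖z - w‖ ^ (1 - s)

open Set Real intervalIntegral MeasureTheory

/-! Rotation about the y-axis gives |R_φ z - w|² = |z - w|² + 4 Re z Re w sin²(φ/2). With l = 2√(Re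
z Re w) and ε = |z - w|/l, scaling and symmetry turn the kernel into (2/π) l^{-s} J(ε), where J(ε) =
∫_0^{π/2} (ε² + sin² θ)^{-s/2} dθ (`rieszKernel_eq`). After the shift by R one has l ≈ 2R and ε → 0,
so everything rests on J near 0.

Write 1 = (1 - cos θ) + cos θ under the integral (`angularIntegral_eq_add`). For s < 2 the factor 1
- cos θ ≤ sin² θ tames the singularity, and the first half has a limit with error O(s ε^{2-s}). In
the second half t = sin θ leaves ∫_0^1 (ε² + t²)^{-s/2} dt; integration by parts and t = ε tan φ
reduce it to 1/(1-s) minus a Wallis multiple of ε^{1-s}. The limit of the first half contains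
-1/(1-s), which cancels, so J = a - b ε^{1-s} + O(s ε^{2-s}) on both sides of s = 1
(`abs_angularIntegral_sub_le`).

Multiplication by l^{-s} turns ε^{1-s} into |z - w|^{1-s}/l and the error into |z - w|^{2-s}/l²,
whence the order R^{-2} for every s. Expanding a l^{-s} in 1/R produces the circle energy and the
Re[z - w_*] term. For s > 1, including s ≥ 2, the rescaled limit needs only the dominant term of J
(`abs_rpow_mul_angularIntegral_sub_le`). -/

/-! ### Beta and Wallis integrals -/

lemma integral_rpow_mul_one_sub_rpow {α β : ℝ} (hα : 0 < α) (hβ : 0 < β) :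
    ∫ x in (0 : ℝ)..1, x ^ (α - 1) * (1 - x) ^ (β - 1) = Gamma α * Gamma β / Gamma (α + β) := by
  have h := ProbabilityTheory.beta_eq_betaIntegralReal α β hα hβ
  rw [ProbabilityTheory.beta] at h
  rw [h, Complex.betaIntegral, integral_of_le zero_le_one, integral_of_le zero_le_one,
    ← RCLike.re_to_complex, ← integral_re]
  · refine setIntegral_congr_fun measurableSet_Ioc fun x ⟨hx1, hx2⟩ ↦ ?_
    norm_cast
    rw [← Complex.ofReal_cpow, ← Complex.ofReal_cpow, RCLike.re_to_complex,
      Complex.re_mul_ofReal, Complex.ofReal_re]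
    all_goals linarith
  · have := Complex.betaIntegral_convergent (u := α) (v := β) (by simpa) (by simpa)
    rwa [intervalIntegrable_iff_integrableOn_Ioc_of_le (by simp), IntegrableOn] at this

/-- The Wallis integral `∫_0^{π/2} sin^p θ dθ` with a real exponent. -/
noncomputable def wallisIntegral (p : ℝ) : ℝ := ∫ θ in (0 : ℝ)..π / 2, sin θ ^ p

lemma sin_cos_pos {θ : ℝ} (h : θ ∈ Ioo 0 (π / 2)) : 0 < sin θ ∧ 0 < cos θ :=
  ⟨sin_pos_of_pos_of_lt_pi h.1 (by linarith [h.2, pi_pos]),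
    cos_pos_of_mem_Ioo ⟨by linarith [h.1, pi_pos], h.2⟩⟩

lemma sin_cos_nonneg {θ : ℝ} (h : θ ∈ Icc 0 (π / 2)) : 0 ≤ sin θ ∧ 0 ≤ cos θ :=
  ⟨sin_nonneg_of_nonneg_of_le_pi h.1 (by linarith [h.2, pi_pos]),
    cos_nonneg_of_mem_Icc ⟨by linarith [h.1, pi_pos], h.2⟩⟩

/-- Endpoints are left out because the identities to be used divide by sin or cos, which vanish
there. -/
lemma integral_congr_Ioo {f g : ℝ → ℝ} {a b : ℝ} (hab : a ≤ b) (h : ∀ x ∈ Ioo a b, f x = g x) :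
    ∫ x in a..b, f x = ∫ x in a..b, g x := by
  rw [integral_of_le hab, integral_of_le hab, integral_Ioc_eq_integral_Ioo,
    integral_Ioc_eq_integral_Ioo]
  exact setIntegral_congr_fun measurableSet_Ioo h

lemma intervalIntegrable_congr_Ioo {f g : ℝ → ℝ} {a b : ℝ} (hab : a ≤ b)
    (h : ∀ x ∈ Ioo a b, f x = g x) (hf : IntervalIntegrable f volume a b) :
    IntervalIntegrable g volume a b := by
  rw [intervalIntegrable_iff_integrableOn_Ioo_of_le hab] at hf ⊢
  exact hf.congr_fun h measurableSet_Ioo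

/-- The substitution x = sin² θ turns the Beta integral with parameters (p+1)/2 and 1/2 into twice
the Wallis integral. -/
lemma wallisIntegral_eq {p : ℝ} (hp : 0 < p) :
    wallisIntegral p = √π * Gamma ((p + 1) / 2) / (2 * Gamma (p / 2 + 1)) := by
  have hpi : (0 : ℝ) ≤ π / 2 := by positivity
  have hB := integral_rpow_mul_one_sub_rpow (α := (p + 1) / 2) (β := 1 / 2)
    (by positivity) (by norm_num)
  rw [Gamma_one_half_eq] at hB
  have hsub := integral_comp_mul_deriv_of_deriv_nonneg (a := 0) (b := π / 2)
    (f := fun θ => sin θ ^ 2) (f' := fun θ => 2 * sin θ * cos θ)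
    (g := fun x => x ^ ((p + 1) / 2 - 1) * (1 - x) ^ ((1 : ℝ) / 2 - 1)) (by fun_prop)
    (fun x _ => by simpa using (hasDerivAt_sin x).fun_pow 2)
    (fun x hx => by
      rw [min_eq_left hpi, max_eq_right hpi] at hx
      obtain ⟨h1, h2⟩ := sin_cos_pos hx
      positivity)
  simp only [sin_zero, sin_pi_div_two, Function.comp] at hsub
  norm_num at hsub hB
  rw [hB] at hsub
  have hcongr : ∫ θ in (0 : ℝ)..π / 2, (sin θ ^ 2) ^ ((p + 1) / 2 - 1) *
      (1 - sin θ ^ 2) ^ (-(1 / 2) : ℝ) * (2 * sin θ * cos θ) =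
      ∫ θ in (0 : ℝ)..π / 2, 2 * sin θ ^ p := by
    refine integral_congr_Ioo hpi fun θ hθ => ?_
    obtain ⟨h1, h2⟩ := sin_cos_pos hθ
    rw [← cos_sq', ← rpow_natCast, ← rpow_natCast, ← rpow_mul h1.le, ← rpow_mul h2.le]
    have e1 : ((2 : ℕ) : ℝ) * ((p + 1) / 2 - 1) = p - 1 := by push_cast; ring
    have e2 : ((2 : ℕ) : ℝ) * (-(1 / 2)) = -1 := by norm_num
    rw [e1, e2, rpow_sub_one h1.ne', rpow_neg_one]
    field_simp
  rw [hcongr, intervalIntegral.integral_const_mul] at hsub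
  have e3 : (p + 1) / 2 + 1 / 2 = p / 2 + 1 := by ring
  rw [e3] at hsub
  rw [wallisIntegral, eq_div_iff (mul_ne_zero two_ne_zero (Gamma_pos_of_pos (by positivity)).ne')]
  rw [eq_div_iff (Gamma_pos_of_pos (by positivity)).ne'] at hsub
  linarith

lemma intervalIntegrable_sin_rpow {p : ℝ} (hp : 0 ≤ p) (a b : ℝ) :
    IntervalIntegrable (fun θ => sin θ ^ p) volume a b :=
  (continuous_sin.rpow_const fun _ => Or.inr hp).intervalIntegrable _ _

lemma wallisIntegral_nonneg (p : ℝ) : 0 ≤ wallisIntegral p :=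
  integral_nonneg (by positivity) fun _ hθ => rpow_nonneg (sin_cos_nonneg hθ).1 _

lemma wallisIntegral_le {p : ℝ} (hp : 0 ≤ p) : wallisIntegral p ≤ π / 2 := by
  have h := integral_mono_on (by positivity) (intervalIntegrable_sin_rpow hp 0 (π / 2))
    (intervalIntegrable_const (c := (1 : ℝ)))
    fun θ hθ => rpow_le_one (sin_cos_nonneg hθ).1 (sin_le_one θ) hp
  simpa [wallisIntegral] using h

/-! ### Two exact identities from integration by parts -/

/-- The identity `(1 - s) ∫ sin^{2-s} / (1 + cos) = (2 - s) ∫ sin^{2-s} - 1`; the integrand on the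
left is `sin^{-s} (1 - cos)`. -/
lemma one_sub_mul_integral_sin_rpow_div {s : ℝ} (hs2 : s < 2) :
    (1 - s) * ∫ θ in (0 : ℝ)..π / 2, sin θ ^ (2 - s) / (1 + cos θ) =
      (2 - s) * wallisIntegral (2 - s) - 1 := by
  have hpi : (0 : ℝ) ≤ π / 2 := by positivity
  have hpos : ∀ θ ∈ Icc 0 (π / 2), 1 + cos θ ≠ 0 := fun θ hθ => by
    linarith [(sin_cos_nonneg hθ).2]
  have hu : uIcc 0 (π / 2) = Icc 0 (π / 2) := uIcc_of_le hpi
  have c1 : IntervalIntegrable (fun θ => sin θ ^ (2 - s) / (1 + cos θ)) volume 0 (π / 2) := by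
    refine ContinuousOn.intervalIntegrable ?_
    rw [hu]
    exact ((continuous_sin.rpow_const fun _ => Or.inr (by linarith)).continuousOn).div
      (by fun_prop) hpos
  have c2 := intervalIntegrable_sin_rpow (p := 2 - s) (by linarith) 0 (π / 2)
  -- The antiderivative equals -sin^{1-s} (1 - cos); writing it with 1 + cos in the denominator
  -- keeps it continuous at 0. Its value at π/2 is the -1 of the identity.
  have key := integral_eq_sub_of_hasDerivAt_of_le hpi
    (f := fun θ => -(sin θ ^ (3 - s) / (1 + cos θ)))
    (f' := fun θ => (1 - s) * (sin θ ^ (2 - s) / (1 + cos θ)) - (2 - s) * sin θ ^ (2 - s))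
    (((continuous_sin.rpow_const fun _ => Or.inr (by linarith)).continuousOn).div
      (by fun_prop) hpos).neg ?_ ((c1.const_mul _).sub (c2.const_mul _))
  · rw [intervalIntegral.integral_sub (c1.const_mul _) (c2.const_mul _),
      intervalIntegral.integral_const_mul, intervalIntegral.integral_const_mul] at key
    simp [zero_rpow (show 3 - s ≠ 0 by linarith)] at key
    rw [wallisIntegral]
    linarith
  · intro θ hθ
    obtain ⟨h1, h2⟩ := sin_cos_pos hθ
    have hne : 1 + cos θ ≠ 0 := by positivity
    have hd := (((hasDerivAt_sin θ).rpow_const (p := 3 - s) (Or.inl h1.ne')).div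
      ((hasDerivAt_cos θ).const_add 1) hne).neg
    refine hd.congr_deriv ?_
    have e1 : 3 - s - 1 = 2 - s := by ring
    have e2 : sin θ ^ (3 - s) = sin θ ^ (2 - s) * sin θ := by
      rw [← rpow_add_one h1.ne']; ring_nf
    rw [e1, e2]
    field_simp
    have := sin_sq_add_cos_sq θ
    linear_combination -this

/-- The recursion for `∫_0^1 (ε² + t²)^{-s/2} dt`. -/
lemma one_sub_mul_integral_sq_add_sq_rpow {s ε : ℝ} (hε : 0 < ε) :
    (1 - s) * ∫ t in (0 : ℝ)..1, (ε ^ 2 + t ^ 2) ^ (-s / 2) =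
      (1 + ε ^ 2) ^ (-s / 2) -
        s * (ε ^ (1 - s) * ∫ φ in (0 : ℝ)..arctan (1 / ε), cos φ ^ s) := by
  have hq : ∀ t : ℝ, ε ^ 2 + t ^ 2 ≠ 0 := fun t => by positivity
  have c : ∀ p : ℝ, Continuous fun t : ℝ => (ε ^ 2 + t ^ 2) ^ p := fun p =>
    (by fun_prop : Continuous fun t : ℝ => ε ^ 2 + t ^ 2).rpow_const fun t => Or.inl (hq t)
  -- Differentiating the product and replacing t² by (ε² + t²) - ε² yields the two powers in `f'`.
  have key := integral_eq_sub_of_hasDerivAt (a := 0) (b := 1)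
    (f := fun t : ℝ => t * (ε ^ 2 + t ^ 2) ^ (-s / 2))
    (f' := fun t => (1 - s) * (ε ^ 2 + t ^ 2) ^ (-s / 2) +
      s * ε ^ 2 * (ε ^ 2 + t ^ 2) ^ (-s / 2 - 1)) ?_
    ((((c _).const_mul _).add ((c _).const_mul _)).intervalIntegrable _ _)
  · rw [intervalIntegral.integral_add (((c _).const_mul _).intervalIntegrable _ _)
      (((c _).const_mul _).intervalIntegrable _ _),
      intervalIntegral.integral_const_mul, intervalIntegral.integral_const_mul] at key
    have harc : 0 ≤ arctan (1 / ε) := arctan_nonneg.2 (by positivity)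
    have hcos : ∀ φ ∈ Icc 0 (arctan (1 / ε)), 0 < cos φ := fun φ hφ =>
      cos_pos_of_mem_Ioo ⟨by linarith [hφ.1, pi_pos], hφ.2.trans_lt (arctan_lt_pi_div_two _)⟩
    -- With t = ε tan φ the power -s/2 - 1 becomes ε^{-s-1} cos^s φ.
    have hsub := integral_comp_mul_deriv_of_deriv_nonneg (a := 0) (b := arctan (1 / ε))
      (f := fun φ => ε * tan φ) (f' := fun φ => ε * (1 / cos φ ^ 2))
      (g := fun t => (ε ^ 2 + t ^ 2) ^ (-s / 2 - 1))
      (by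
        rw [uIcc_of_le harc]
        exact fun φ hφ =>
          ((hasDerivAt_tan (hcos φ hφ).ne').continuousAt.const_mul ε).continuousWithinAt)
      (fun φ hφ => by
        rw [min_eq_left harc, max_eq_right harc] at hφ
        exact (hasDerivAt_tan (hcos φ (Ioo_subset_Icc_self hφ)).ne').const_mul ε)
      (fun φ _ => by positivity)
    simp only [tan_zero, mul_zero, tan_arctan, mul_one_div_cancel hε.ne', Function.comp] at hsub
    have hcongr : ∫ φ in (0 : ℝ)..arctan (1 / ε),
        (ε ^ 2 + (ε * tan φ) ^ 2) ^ (-s / 2 - 1) * (ε * (1 / cos φ ^ 2)) =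
        ∫ φ in (0 : ℝ)..arctan (1 / ε), ε ^ (-s - 1) * cos φ ^ s := by
      refine integral_congr_Ioo harc fun φ hφ => ?_
      have h := hcos φ (Ioo_subset_Icc_self hφ)
      have e1 : ε ^ 2 + (ε * tan φ) ^ 2 = (ε / cos φ) ^ (2 : ℝ) := by
        rw [tan_eq_sin_div_cos, rpow_two]
        field_simp
        linarith [sin_sq_add_cos_sq φ]
      have e2 : (2 : ℝ) * (-s / 2 - 1) = -s - 1 - 1 := by ring
      rw [e1, ← rpow_mul (by positivity), e2, div_rpow hε.le h.le, rpow_sub_one hε.ne' (-s - 1),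
        rpow_sub_one h.ne', rpow_sub_one h.ne', rpow_neg h.le]
      field_simp
    rw [hcongr, intervalIntegral.integral_const_mul] at hsub
    rw [← hsub] at key
    have e3 : ε ^ (1 - s) = ε ^ 2 * ε ^ (-s - 1) := by
      rw [← rpow_natCast, ← rpow_add hε]; congr 1; push_cast; ring
    rw [e3]
    norm_num at key
    rw [add_comm 1 (ε ^ 2), one_div]
    linear_combination key
  · intro t _
    have hd := (hasDerivAt_id' t).fun_mul ((((hasDerivAt_id' t).fun_pow 2).const_add (ε ^ 2)).rpow_const
      (p := -s / 2) (Or.inl (hq t)))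
    refine hd.congr_deriv ?_
    have e : (ε ^ 2 + t ^ 2) ^ (-s / 2) = (ε ^ 2 + t ^ 2) ^ (-s / 2 - 1) * (ε ^ 2 + t ^ 2) := by
      rw [← rpow_add_one (hq t)]; ring_nf
    rw [e]
    push_cast
    ring

/-! ### Bernoulli-type inequalities -/

lemma one_sub_mul_le_one_add_rpow_neg {p y : ℝ} (hp0 : 0 ≤ p) (hp1 : p ≤ 1) (hy : 0 ≤ y) :
    1 - p * y ≤ (1 + y) ^ (-p) := by
  have h := rpow_one_add_le_one_add_mul_self (s := y) (by linarith) hp0 hp1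
  have hpos : 0 < (1 + y) ^ p := rpow_pos_of_pos (by linarith) _
  have hpy : 0 ≤ p * y := by positivity
  rw [rpow_neg (by linarith)]
  calc 1 - p * y ≤ (1 + p * y)⁻¹ := by
        rw [← one_div, le_div_iff₀ (by linarith)]
        nlinarith
    _ ≤ _ := inv_anti₀ hpos h

/-- Apply Bernoulli to (1+y)^{1-p} and use (1 - py + py²)(1+y) = 1 + (1-p)y + py³. -/
lemma one_add_rpow_neg_le {p y : ℝ} (hp0 : 0 ≤ p) (hp1 : p ≤ 1) (hy : 0 ≤ y) :
    (1 + y) ^ (-p) ≤ 1 - p * y + p * y ^ 2 := by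
  have h := rpow_one_add_le_one_add_mul_self (s := y) (p := 1 - p) (by linarith)
    (by linarith) (by linarith)
  have hy1 : 0 < 1 + y := by linarith
  have e : (1 + y) ^ (-p) = (1 + y) ^ (1 - p) / (1 + y) := by
    rw [← rpow_sub_one hy1.ne']; congr 1; ring
  rw [e, div_le_iff₀ hy1]
  have : 0 ≤ p * y ^ 3 := by positivity
  nlinarith

/-- The factor s on the right is what makes the final error O(s/R²) as s → 0. For large x and s < 1
it comes from comparing 1 + x² with (1 + x)². -/
lemma one_sub_one_add_sq_rpow_le {s x : ℝ} (hs0 : 0 < s) (hs2 : s < 2) (hx : 0 < x) :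
    1 - (1 + x ^ 2) ^ (-s / 2) ≤ s * x ^ (2 - s) := by
  rw [neg_div]
  rcases le_total x 1 with h1 | h1
  · have h := one_sub_mul_le_one_add_rpow_neg (p := s / 2) (y := x ^ 2) (by linarith) (by linarith)
      (by positivity)
    have h2 : x ^ (2 : ℝ) ≤ x ^ (2 - s) := rpow_le_rpow_of_exponent_ge hx h1 (by linarith)
    rw [rpow_two] at h2
    nlinarith [sq_nonneg x]
  · rcases le_total 1 s with hs | hs
    · have h2 : 1 ≤ x ^ (2 - s) := one_le_rpow h1 (by linarith)
      have h3 : 0 < (1 + x ^ 2) ^ (-(s / 2)) := by positivity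
      nlinarith
    · have h := one_sub_mul_le_one_add_rpow_neg (p := s) (y := x) hs0.le hs hx.le
      have h2 : x ^ (1 : ℝ) ≤ x ^ (2 - s) := rpow_le_rpow_of_exponent_le h1 (by linarith)
      rw [rpow_one] at h2
      have h3 : (1 + x) ^ (-s) ≤ (1 + x ^ 2) ^ (-(s / 2)) := by
        have e : (1 + x) ^ (-s) = ((1 + x) ^ (2 : ℝ)) ^ (-(s / 2)) := by
          rw [← rpow_mul (by linarith)]; congr 1; ring
        rw [e]
        refine rpow_le_rpow_of_nonpos (by positivity) ?_ (by linarith)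
        rw [rpow_two]; nlinarith
      nlinarith

lemma sq_rpow_neg_half {t : ℝ} (ht : 0 ≤ t) (s : ℝ) : (t ^ 2) ^ (-s / 2) = t ^ (-s) := by
  rw [← rpow_natCast, ← rpow_mul ht]; congr 1; push_cast; ring

lemma sq_add_sq_rpow_le {s ε t : ℝ} (hs0 : 0 < s) (ht : 0 < t) :
    (ε ^ 2 + t ^ 2) ^ (-s / 2) ≤ t ^ (-s) := by
  rw [← sq_rpow_neg_half ht.le]
  exact rpow_le_rpow_of_nonpos (by positivity) (by nlinarith) (by linarith)

/-- The preceding bound at x = ε/t, made homogeneous. The weight t² will be supplied by 1 - cos θ ≤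
sin² θ. -/
lemma rpow_neg_sub_sq_add_sq_rpow_le {s ε t : ℝ} (hs0 : 0 < s) (hs2 : s < 2) (hε : 0 < ε)
    (ht : 0 < t) : (t ^ (-s) - (ε ^ 2 + t ^ 2) ^ (-s / 2)) * t ^ 2 ≤ s * ε ^ (2 - s) := by
  have h := one_sub_one_add_sq_rpow_le hs0 hs2 (div_pos hε ht)
  have e1 : (ε ^ 2 + t ^ 2) ^ (-s / 2) = t ^ (-s) * (1 + (ε / t) ^ 2) ^ (-s / 2) := by
    rw [← sq_rpow_neg_half ht.le, ← mul_rpow (by positivity) (by positivity)]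
    congr 1; field_simp; ring
  have e2 : ε ^ (2 - s) = t ^ (-s) * t ^ 2 * (ε / t) ^ (2 - s) := by
    have : t ^ (2 - s) = t ^ (-s) * t ^ 2 := by
      rw [← rpow_natCast, ← rpow_add ht]; congr 1; push_cast; ring
    rw [← this, ← mul_rpow ht.le (by positivity), mul_div_cancel₀ _ ht.ne']
  rw [e1, e2]
  have h3 : 0 ≤ t ^ (-s) * t ^ 2 := by positivity
  nlinarith [mul_le_mul_of_nonneg_left h h3]

/-! ### The angular integral for small ε -/

/-- The integral `∫_0^{π/2} (ε² + sin² θ)^{-s/2} dθ`. -/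
noncomputable def angularIntegral (s ε : ℝ) : ℝ :=
  ∫ θ in (0 : ℝ)..π / 2, (ε ^ 2 + sin θ ^ 2) ^ (-s / 2)

lemma continuous_sq_add_sin_sq_rpow {ε : ℝ} (hε : 0 < ε) (p : ℝ) :
    Continuous fun θ : ℝ => (ε ^ 2 + sin θ ^ 2) ^ p :=
  (by fun_prop : Continuous fun θ : ℝ => ε ^ 2 + sin θ ^ 2).rpow_const
    fun θ => Or.inl (by positivity)

lemma intervalIntegrable_sin_rpow_div {s : ℝ} (hs2 : s < 2) :
    IntervalIntegrable (fun θ => sin θ ^ (2 - s) / (1 + cos θ)) volume 0 (π / 2) := by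
  refine ContinuousOn.intervalIntegrable ?_
  rw [uIcc_of_le (by positivity)]
  exact ((continuous_sin.rpow_const fun _ => Or.inr (by linarith)).continuousOn).div
    (by fun_prop) fun θ hθ => by linarith [(sin_cos_nonneg hθ).2]

lemma sin_rpow_mul_one_sub_cos {s θ : ℝ} (hθ : θ ∈ Ioo 0 (π / 2)) :
    sin θ ^ (-s) * (1 - cos θ) = sin θ ^ (2 - s) / (1 + cos θ) := by
  obtain ⟨h1, h2⟩ := sin_cos_pos hθ
  have e : sin θ ^ (2 - s) = sin θ ^ (-s) * sin θ ^ 2 := by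
    rw [← rpow_natCast, ← rpow_add h1]; congr 1; push_cast; ring
  rw [e, eq_div_iff (by positivity), sin_sq]; ring

lemma one_sub_cos_le_sin_sq {θ : ℝ} (hθ : θ ∈ Ioo 0 (π / 2)) : 1 - cos θ ≤ sin θ ^ 2 := by
  rw [sin_sq]; nlinarith [(sin_cos_pos hθ).2, cos_le_one θ]

lemma abs_integral_le_of_Ioo {f : ℝ → ℝ} {a b C : ℝ} (hab : a ≤ b)
    (h : ∀ x ∈ Ioo a b, |f x| ≤ C) : |∫ x in a..b, f x| ≤ C * (b - a) := by
  rw [integral_of_le hab, integral_Ioc_eq_integral_Ioo]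
  have := norm_setIntegral_le_of_norm_le_const (μ := volume) (s := Ioo a b) (f := f)
    (C := C) (by simp) (fun x hx => h x hx)
  simpa [Measure.real, ENNReal.toReal_ofReal (sub_nonneg.2 hab)] using this

lemma hasDerivAt_sin_rpow_div {s : ℝ} (hs : s < 1) {θ : ℝ} (hθ : θ ∈ Ioo 0 (π / 2)) :
    HasDerivAt (fun θ => sin θ ^ (1 - s) / (1 - s)) (sin θ ^ (-s) * cos θ) θ := by
  refine (((hasDerivAt_sin θ).rpow_const (p := 1 - s)
    (Or.inl (sin_cos_pos hθ).1.ne')).div_const (1 - s)).congr_deriv ?_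
  have : 1 - s ≠ 0 := by linarith
  rw [show 1 - s - 1 = -s by ring]; field_simp

lemma continuous_sin_rpow_div {s : ℝ} (hs : s < 1) :
    Continuous fun θ => sin θ ^ (1 - s) / (1 - s) :=
  (continuous_sin.rpow_const fun _ => Or.inr (by linarith)).div_const _

/-- Despite the singularity at 0, a nonnegative derivative of a continuous function is integrable.
-/
lemma intervalIntegrable_sin_rpow_mul_cos {s : ℝ} (hs : s < 1) :
    IntervalIntegrable (fun θ => sin θ ^ (-s) * cos θ) volume 0 (π / 2) := by
  have hpi : (0 : ℝ) ≤ π / 2 := by positivity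
  refine intervalIntegrable_deriv_of_nonneg (continuous_sin_rpow_div hs).continuousOn
    (fun θ hθ => hasDerivAt_sin_rpow_div hs ?_) (fun θ hθ => ?_)
  all_goals rw [min_eq_left hpi, max_eq_right hpi] at hθ
  · exact hθ
  · have := sin_cos_pos hθ
    exact mul_nonneg (rpow_nonneg this.1.le _) this.2.le

lemma zero_sq_add_sin_sq_rpow {s θ : ℝ} (hθ : θ ∈ Ioo 0 (π / 2)) :
    sin θ ^ (2 - s) / (1 + cos θ) + sin θ ^ (-s) * cos θ =
      ((0 : ℝ) ^ 2 + sin θ ^ 2) ^ (-s / 2) := by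
  rw [← sin_rpow_mul_one_sub_cos hθ, zero_pow two_ne_zero, zero_add,
    sq_rpow_neg_half (sin_cos_pos hθ).1.le]
  ring

lemma intervalIntegrable_sq_add_sin_sq_rpow {s ε : ℝ} (hε : 0 ≤ ε) (h : 0 < ε ∨ s < 1) :
    IntervalIntegrable (fun θ => (ε ^ 2 + sin θ ^ 2) ^ (-s / 2)) volume 0 (π / 2) := by
  rcases hε.eq_or_lt with rfl | hε
  · have hs := h.resolve_left (lt_irrefl _)
    exact intervalIntegrable_congr_Ioo (by positivity) (fun θ hθ => zero_sq_add_sin_sq_rpow hθ)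
      ((intervalIntegrable_sin_rpow_div (by linarith)).add (intervalIntegrable_sin_rpow_mul_cos hs))
  · exact (continuous_sq_add_sin_sq_rpow hε _).intervalIntegrable _ _

lemma angularIntegral_zero {s : ℝ} (hs : s < 1) :
    angularIntegral s 0 = (2 - s) / (1 - s) * wallisIntegral (2 - s) := by
  have hpi : (0 : ℝ) ≤ π / 2 := by positivity
  have i2 := intervalIntegrable_sin_rpow_mul_cos hs
  rw [angularIntegral, ← integral_congr_Ioo hpi fun θ hθ => zero_sq_add_sin_sq_rpow hθ,
    intervalIntegral.integral_add (intervalIntegrable_sin_rpow_div (by linarith)) i2,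
    integral_eq_sub_of_hasDerivAt_of_le hpi (continuous_sin_rpow_div hs).continuousOn
      (fun θ hθ => hasDerivAt_sin_rpow_div hs hθ) i2]
  have h := one_sub_mul_integral_sin_rpow_div (s := s) (by linarith)
  have hne : 1 - s ≠ 0 := by linarith
  simp only [sin_zero, sin_pi_div_two, one_rpow, zero_rpow hne]
  field_simp
  linarith

/-- The cos θ half is integrated exactly by t = sin θ; the 1 - cos θ half is the tame one. -/
lemma angularIntegral_eq_add {s ε : ℝ} (hε : 0 < ε) :
    angularIntegral s ε =
      (∫ θ in (0 : ℝ)..π / 2, (ε ^ 2 + sin θ ^ 2) ^ (-s / 2) * (1 - cos θ)) +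
        ∫ t in (0 : ℝ)..1, (ε ^ 2 + t ^ 2) ^ (-s / 2) := by
  have c := continuous_sq_add_sin_sq_rpow hε (-s / 2)
  have h := integral_comp_mul_deriv (a := 0) (b := π / 2) (f := sin) (f' := cos)
    (g := fun t : ℝ => (ε ^ 2 + t ^ 2) ^ (-s / 2)) (fun x _ => hasDerivAt_sin x)
    continuous_cos.continuousOn
    ((by fun_prop : Continuous fun t : ℝ => ε ^ 2 + t ^ 2).rpow_const
      fun t => Or.inl (by positivity))
  rw [sin_zero, sin_pi_div_two] at h
  have c1 : Continuous fun θ : ℝ => (ε ^ 2 + sin θ ^ 2) ^ (-s / 2) * (1 - cos θ) := by fun_prop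
  rw [angularIntegral, ← h, add_comm, ← sub_eq_iff_eq_add, ← intervalIntegral.integral_sub
    (c.intervalIntegrable _ _) (c1.intervalIntegrable _ _)]
  congr 1; ext θ; simp only [Function.comp]; ring

/-- The tail `∫_{arctan (1/ε)}^{π/2} cos^s` is at most `ε^{1+s}`. -/
lemma abs_integral_cos_rpow_sub_wallisIntegral_le {s ε : ℝ} (hs0 : 0 < s) (hε : 0 < ε) :
    |(∫ φ in (0 : ℝ)..arctan (1 / ε), cos φ ^ s) - wallisIntegral s| ≤ ε ^ s * ε := by
  have hc : Continuous fun φ => cos φ ^ s := continuous_cos.rpow_const fun _ => Or.inr hs0.le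
  have hW : wallisIntegral s = ∫ φ in (0 : ℝ)..π / 2, cos φ ^ s := by
    have := integral_comp_sub_left (a := 0) (b := π / 2) (fun x => sin x ^ s) (π / 2)
    simpa [sin_pi_div_two_sub, wallisIntegral] using this.symm
  have h0 : 0 ≤ arctan ε := arctan_nonneg.2 hε.le
  have ha : arctan ε ≤ ε := by
    have h1 := le_tan h0 (arctan_lt_pi_div_two _)
    rwa [tan_arctan] at h1
  rw [hW, one_div, arctan_inv_of_pos hε, abs_sub_comm,
    integral_interval_sub_left (hc.intervalIntegrable _ _) (hc.intervalIntegrable _ _)]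
  -- The interval has length arctan ε ≤ ε, and cos ≤ ε on it.
  have h := abs_integral_le_of_Ioo (f := fun φ => cos φ ^ s) (a := π / 2 - arctan ε) (b := π / 2)
    (C := ε ^ s) (by linarith) fun x hx => by
      have hcos : 0 ≤ cos x :=
        cos_nonneg_of_mem_Icc ⟨by linarith [hx.1, arctan_lt_pi_div_two ε, pi_pos], hx.2.le⟩
      have h2 : cos x ≤ ε := by
        rw [← sin_pi_div_two_sub]
        have := sin_le (x := π / 2 - x) (by linarith [hx.2])
        linarith [hx.1]
      rw [abs_of_nonneg (rpow_nonneg hcos _)]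
      exact rpow_le_rpow hcos h2 hs0.le
  refine h.trans (mul_le_mul_of_nonneg_left (by linarith) (by positivity))

/-- The expansion of `angularIntegral s ε` as `ε → 0`, with a remainder `O(s ε^{2-s})`. -/
theorem abs_angularIntegral_sub_le {s ε : ℝ} (hs0 : 0 < s) (hs2 : s < 2) (hs1 : s ≠ 1)
    (hε0 : 0 ≤ ε) (hε1 : ε ≤ 1) (h : 0 < ε ∨ s < 1) :
    |angularIntegral s ε - ((2 - s) / (1 - s) * wallisIntegral (2 - s) -
      s / (1 - s) * wallisIntegral s * ε ^ (1 - s))| ≤ (2 + 2 / |1 - s|) * (s * ε ^ (2 - s)) := by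
  have hne : 1 - s ≠ 0 := sub_ne_zero.2 hs1.symm
  have hpos : 0 < |1 - s| := abs_pos.2 hne
  -- At ε = 0, the case z = w, the expansion is exact.
  rcases hε0.eq_or_lt with rfl | hε
  · rw [angularIntegral_zero (h.resolve_left (lt_irrefl _)), zero_rpow hne,
      zero_rpow (by linarith)]
    simp
  have hpi : (0 : ℝ) ≤ π / 2 := by positivity
  have c := continuous_sq_add_sin_sq_rpow hε (-s / 2)
  have hD := one_sub_mul_integral_sin_rpow_div hs2
  have hQ := one_sub_mul_integral_sq_add_sq_rpow (s := s) hε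
  have htail := abs_integral_cos_rpow_sub_wallisIntegral_le hs0 hε
  rw [angularIntegral_eq_add hε]
  have hPD : |(∫ θ in (0 : ℝ)..π / 2, (ε ^ 2 + sin θ ^ 2) ^ (-s / 2) * (1 - cos θ)) -
      ∫ θ in (0 : ℝ)..π / 2, sin θ ^ (2 - s) / (1 + cos θ)| ≤ s * ε ^ (2 - s) * (π / 2 - 0) := by
    rw [← intervalIntegral.integral_sub ((by fun_prop : Continuous _).intervalIntegrable _ _)
      (intervalIntegrable_sin_rpow_div hs2)]
    refine abs_integral_le_of_Ioo hpi fun θ hθ => ?_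
    have h1 := (sin_cos_pos hθ).1
    rw [← sin_rpow_mul_one_sub_cos hθ, ← sub_mul, abs_mul, abs_sub_comm,
      abs_of_nonneg (sub_nonneg.2 (sq_add_sq_rpow_le hs0 h1)),
      abs_of_nonneg (sub_nonneg.2 (cos_le_one θ))]
    exact (mul_le_mul_of_nonneg_left (one_sub_cos_le_sin_sq hθ)
      (sub_nonneg.2 (sq_add_sq_rpow_le hs0 h1))).trans
      (rpow_neg_sub_sq_add_sq_rpow_le hs0 hs2 hε h1)
  generalize (∫ θ in (0 : ℝ)..π / 2, (ε ^ 2 + sin θ ^ 2) ^ (-s / 2) * (1 - cos θ)) = P at *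
  generalize (∫ θ in (0 : ℝ)..π / 2, sin θ ^ (2 - s) / (1 + cos θ)) = D at *
  generalize (∫ t in (0 : ℝ)..1, (ε ^ 2 + t ^ 2) ^ (-s / 2)) = Q at *
  generalize (∫ φ in (0 : ℝ)..arctan (1 / ε), cos φ ^ s) = T at *
  -- The constants 1/(1-s) from P's limit D and from Q cancel here.
  have e : P + Q - ((2 - s) / (1 - s) * wallisIntegral (2 - s) -
      s / (1 - s) * wallisIntegral s * ε ^ (1 - s)) =
      (P - D) + (((1 + ε ^ 2) ^ (-s / 2) - 1) - s * ε ^ (1 - s) * (T - wallisIntegral s)) /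
        (1 - s) := by
    rw [neg_div] at *
    field_simp
    linear_combination hQ + hD
  have hε2 : ε ^ 2 ≤ ε ^ (2 - s) := by
    rw [← rpow_two]; exact rpow_le_rpow_of_exponent_ge hε hε1 (by linarith)
  have b1 : |(1 + ε ^ 2) ^ (-s / 2) - 1| ≤ s / 2 * ε ^ 2 := by
    have h1 := one_sub_mul_le_one_add_rpow_neg (p := s / 2) (y := ε ^ 2) (by linarith)
      (by linarith) (by positivity)
    have h2 : (1 + ε ^ 2) ^ (-(s / 2)) ≤ 1 :=
      rpow_le_one_of_one_le_of_nonpos (by nlinarith) (by linarith)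
    rw [neg_div, abs_sub_comm, abs_of_nonneg (by linarith)]
    linarith
  have b2 : |s * ε ^ (1 - s) * (T - wallisIntegral s)| ≤ s * ε ^ 2 := by
    have e3 : s * ε ^ 2 = s * ε ^ (1 - s) * (ε ^ s * ε) := by
      have : ε ^ (1 - s) * ε ^ s = ε := by rw [← rpow_add hε]; simp
      linear_combination (-s * ε) * this
    rw [abs_mul, abs_of_nonneg (by positivity : 0 ≤ s * ε ^ (1 - s)), e3]
    exact mul_le_mul_of_nonneg_left htail (by positivity)
  rw [e]
  refine (abs_add_le _ _).trans ?_
  rw [abs_div, add_mul]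
  -- The constant 2 bounds π/2; the other 2 bounds 1/2 + 1 from `b1` and `b2`, using ε² ≤ ε^{2-s}.
  refine add_le_add (hPD.trans ?_) ?_
  · have := pi_le_four
    have : 0 ≤ s * ε ^ (2 - s) := by positivity
    nlinarith
  · rw [div_mul_eq_mul_div]
    refine div_le_div_of_nonneg_right ?_ hpos.le
    refine (abs_sub _ _).trans ?_
    nlinarith

/-- The behaviour of `angularIntegral s ε` as `ε → 0` for `s > 1`. -/
theorem abs_rpow_mul_angularIntegral_sub_le {s ε : ℝ} (hs : 1 < s) (hε : 0 < ε) (hε1 : ε ≤ 1) :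
    |ε ^ (s - 1) * angularIntegral s ε - s / (s - 1) * wallisIntegral s| ≤
      (2 + (1 + s) / (s - 1)) * (ε + ε ^ (s - 1)) := by
  have hpi : (0 : ℝ) ≤ π / 2 := by positivity
  have hs0 : 0 < s := by linarith
  have hs1 : 0 < s - 1 := by linarith
  have hQ := one_sub_mul_integral_sq_add_sq_rpow (s := s) hε
  have htail := abs_integral_cos_rpow_sub_wallisIntegral_le hs0 hε
  have hP : |∫ θ in (0 : ℝ)..π / 2, ε ^ (s - 1) *
      ((ε ^ 2 + sin θ ^ 2) ^ (-s / 2) * (1 - cos θ))| ≤ (ε + ε ^ (s - 1)) * (π / 2 - 0) := by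
    refine abs_integral_le_of_Ioo hpi fun θ hθ => ?_
    have h1 := (sin_cos_pos hθ).1
    have hq : 0 ≤ 1 - cos θ := sub_nonneg.2 (cos_le_one θ)
    rw [abs_of_nonneg (by positivity)]
    -- For s ≤ 2 the unscaled integrand is at most 1, for s ≥ 2 at most ε^{2-s}. After scaling these
    -- give ε^{s-1} and ε.
    rcases le_total s 2 with h2 | h2
    · have h3 : (ε ^ 2 + sin θ ^ 2) ^ (-s / 2) * (1 - cos θ) ≤ 1 := by
        calc _ ≤ sin θ ^ (-s) * sin θ ^ 2 :=
              mul_le_mul (sq_add_sq_rpow_le hs0 h1) (one_sub_cos_le_sin_sq hθ) hq (by positivity)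
          _ = sin θ ^ (2 - s) := by
              rw [← rpow_natCast, ← rpow_add h1]; congr 1; push_cast; ring
          _ ≤ 1 := rpow_le_one h1.le (sin_le_one θ) (by linarith)
      have : 0 < ε ^ (s - 1) := by positivity
      nlinarith
    · have h3 : (ε ^ 2 + sin θ ^ 2) ^ (-s / 2) * (1 - cos θ) ≤ ε ^ (2 - s) := by
        calc _ ≤ (ε ^ 2 + sin θ ^ 2) ^ (-s / 2) * (ε ^ 2 + sin θ ^ 2) :=
              mul_le_mul_of_nonneg_left (by nlinarith [one_sub_cos_le_sin_sq hθ]) (by positivity)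
          _ = (ε ^ 2 + sin θ ^ 2) ^ (-(s - 2) / 2) := by
              rw [← rpow_add_one (by positivity)]; congr 1; ring
          _ ≤ (ε ^ 2) ^ (-(s - 2) / 2) :=
              rpow_le_rpow_of_nonpos (by positivity) (by nlinarith) (by linarith)
          _ = ε ^ (2 - s) := by rw [sq_rpow_neg_half hε.le]; congr 1; ring
      have h4 : ε ^ (s - 1) * ε ^ (2 - s) = ε := by
        rw [← rpow_add hε]; ring_nf; exact rpow_one ε
      have : 0 < ε ^ (s - 1) := by positivity
      nlinarith
  rw [intervalIntegral.integral_const_mul] at hP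
  rw [angularIntegral_eq_add hε]
  generalize (∫ θ in (0 : ℝ)..π / 2, (ε ^ 2 + sin θ ^ 2) ^ (-s / 2) * (1 - cos θ)) = P at *
  generalize (∫ t in (0 : ℝ)..1, (ε ^ 2 + t ^ 2) ^ (-s / 2)) = Q at *
  generalize (∫ φ in (0 : ℝ)..arctan (1 / ε), cos φ ^ s) = T at *
  have hmul : ε ^ (s - 1) * ε ^ (1 - s) = 1 := by rw [← rpow_add hε]; simp
  have e : ε ^ (s - 1) * (P + Q) - s / (s - 1) * wallisIntegral s = ε ^ (s - 1) * P +
      (s * (T - wallisIntegral s) - ε ^ (s - 1) * (1 + ε ^ 2) ^ (-s / 2)) / (s - 1) := by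
    rw [neg_div] at *
    field_simp
    linear_combination (-ε ^ (s - 1)) * hQ + s * T * hmul
  have b1 : ε ^ s * ε ≤ ε := by
    have := rpow_le_one hε.le hε1 hs0.le
    nlinarith
  have b2 : (1 + ε ^ 2) ^ (-s / 2) ≤ 1 :=
    rpow_le_one_of_one_le_of_nonpos (by nlinarith) (by linarith)
  have b3 : 0 < ε ^ (s - 1) := by positivity
  rw [e]
  refine (abs_add_le _ _).trans ?_
  rw [abs_div, add_mul, abs_of_pos hs1]
  refine add_le_add (hP.trans ?_) ?_
  · nlinarith [pi_le_four]
  · rw [div_mul_eq_mul_div]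
    refine div_le_div_of_nonneg_right ?_ hs1.le
    refine (abs_sub _ _).trans ?_
    rw [abs_mul, abs_of_pos hs0, abs_of_nonneg (by positivity : 0 ≤ ε ^ (s - 1) * _)]
    nlinarith

/-! ### The kernel as an angular integral -/

lemma norm_rotateY_sub_sq (φ : ℝ) (z w : ℂ) :
    ‖rotateY φ (planeToSpace z) - planeToSpace w‖ ^ 2 =
      ‖z - w‖ ^ 2 + 4 * (z.re * w.re) * sin (φ / 2) ^ 2 := by
  have h : cos φ = 1 - 2 * sin (φ / 2) ^ 2 := by
    have := cos_two_mul' (φ / 2)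
    rw [mul_div_cancel₀ _ two_ne_zero, cos_sq'] at this
    linarith
  have h2 := sin_sq_add_cos_sq φ
  rw [EuclideanSpace.norm_sq_eq, Fin.sum_univ_three, ← Complex.normSq_eq_norm_sq,
    Complex.normSq_apply]
  simp only [rotateY, planeToSpace, PiLp.sub_apply, PiLp.toLp_apply, Matrix.cons_val, norm_eq_abs,
    sq_abs, Complex.sub_re, Complex.sub_im]
  linear_combination z.re ^ 2 * h2 - 2 * z.re * w.re * h

lemma integral_comp_sin_half {g : ℝ → ℝ}
    (hg : IntervalIntegrable (fun θ => g (sin θ)) volume 0 (π / 2)) :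
    ∫ φ in (0 : ℝ)..2 * π, g (sin (φ / 2)) = 4 * ∫ θ in (0 : ℝ)..π / 2, g (sin θ) := by
  have hrefl : (fun θ => g (sin (π - θ))) = fun θ => g (sin θ) := by simp [sin_pi_sub]
  have hg' : IntervalIntegrable (fun θ => g (sin θ)) volume (π / 2) π := by
    have := (hg.comp_sub_left π).symm
    rw [hrefl] at this
    convert! this using 1 <;> ring
  have h2 : ∫ θ in (π / 2)..π, g (sin θ) = ∫ θ in (0 : ℝ)..π / 2, g (sin θ) := by
    have := integral_comp_sub_left (a := 0) (b := π / 2) (fun θ => g (sin θ)) π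
    rw [hrefl] at this
    rw [this]
    congr 1 <;> ring
  rw [integral_comp_div (fun θ => g (sin θ)) two_ne_zero, zero_div,
    mul_div_cancel_left₀ _ two_ne_zero, ← integral_add_adjacent_intervals hg hg', h2, smul_eq_mul]
  ring

/-- The reduced kernel in terms of `angularIntegral`. -/
lemma rieszKernel_eq {s : ℝ} {z w : ℂ} (hz : 0 < z.re) (hw : 0 < w.re) (h : z ≠ w ∨ s < 1) :
    rieszKernel s z w = 2 / π * ((2 * √(z.re * w.re)) ^ (-s) *
      angularIntegral s (‖z - w‖ / (2 * √(z.re * w.re)))) := by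
  have hzw : 0 < z.re * w.re := mul_pos hz hw
  set l := 2 * √(z.re * w.re) with hl
  have hl0 : 0 < l := by positivity
  have hl2 : 4 * (z.re * w.re) = l ^ 2 := by rw [hl, mul_pow, sq_sqrt hzw.le]; norm_num
  have hε : 0 ≤ ‖z - w‖ / l := by positivity
  have hint := intervalIntegrable_sq_add_sin_sq_rpow (s := s) hε
    (h.imp_left fun h => div_pos (norm_pos_iff.2 (sub_ne_zero.2 h)) hl0)
  have hfun : (fun φ => 1 / ‖rotateY φ (planeToSpace z) - planeToSpace w‖ ^ s) =
      fun φ => l ^ (-s) * ((‖z - w‖ / l) ^ 2 + sin (φ / 2) ^ 2) ^ (-s / 2) := by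
    ext φ
    rw [one_div, ← rpow_neg (norm_nonneg _), ← sq_rpow_neg_half (norm_nonneg _),
      ← sq_rpow_neg_half hl0.le, norm_rotateY_sub_sq, hl2,
      ← mul_rpow (by positivity) (by positivity)]
    congr 1
    field_simp
  rw [rieszKernel, hfun, intervalIntegral.integral_const_mul,
    integral_comp_sin_half (g := fun t => ((‖z - w‖ / l) ^ 2 + t ^ 2) ^ (-s / 2)) hint,
    ← angularIntegral]
  ring

/-! ### Gamma constants as Wallis integrals -/

/-- The functional equation replaces Γ((1-s)/2) by Γ((3-s)/2), so the formula continues past s = 1,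
where the energy integral diverges. -/
lemma circleEnergy_eq {s : ℝ} (hs2 : s < 2) (hs1 : s ≠ 1) :
    circleEnergy s =
      2 ^ (-s) * (2 / π * ((2 - s) / (1 - s) * wallisIntegral (2 - s))) := by
  have hne : 1 - s ≠ 0 := sub_ne_zero.2 hs1.symm
  have hne2 : 1 - s / 2 ≠ 0 := by linarith
  have hG : Gamma (1 - s / 2) ≠ 0 := (Gamma_pos_of_pos (by linarith)).ne'
  have e1 : Gamma ((2 - s + 1) / 2) = (1 - s) / 2 * Gamma ((1 - s) / 2) := by
    rw [← Gamma_add_one (by simpa using hne)]; congr 1; ring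
  have e2 : Gamma ((2 - s) / 2 + 1) = (1 - s / 2) * Gamma (1 - s / 2) := by
    rw [← Gamma_add_one hne2]; congr 1; ring
  have hne3 : 2 - s ≠ 0 := by linarith
  have hpi : √π ≠ 0 := by positivity
  have hpi2 : √π ^ 2 = π := sq_sqrt pi_pos.le
  have e4 : 1 - s / 2 = (2 - s) / 2 := by ring
  rw [circleEnergy, wallisIntegral_eq (by linarith), e1, e2]
  congr 1
  rw [e4] at *
  generalize Gamma ((2 - s) / 2) = G at *
  generalize Gamma ((1 - s) / 2) = H
  nth_rewrite 2 [← hpi2]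
  field_simp

lemma gamma_div_gamma_eq_wallisIntegral {s : ℝ} (hs : 0 < s) :
    Gamma ((1 + s) / 2) / (√π * Gamma (1 + s / 2)) = 2 / π * wallisIntegral s := by
  have hG : Gamma (1 + s / 2) ≠ 0 := (Gamma_pos_of_pos (by positivity)).ne'
  have hpi : √π ≠ 0 := by positivity
  have hpi2 : √π ^ 2 = π := sq_sqrt pi_pos.le
  rw [wallisIntegral_eq hs, add_comm s 1, add_comm (s / 2) 1]
  nth_rewrite 2 [← hpi2]
  field_simp

lemma limitKernel_eq {s : ℝ} (hs : 0 < s) (z w : ℂ) :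
    limitKernel s z w = -(s / (1 - s) * (2 / π * wallisIntegral s) * ‖z - w‖ ^ (1 - s)) := by
  have hG : Gamma (s / 2) ≠ 0 := (Gamma_pos_of_pos (by positivity)).ne'
  have e : Gamma (1 + s / 2) = s / 2 * Gamma (s / 2) := by
    rw [← Gamma_add_one (by positivity), add_comm]
  rw [limitKernel, ← gamma_div_gamma_eq_wallisIntegral hs, e]
  have : s / (1 - s) * (Gamma ((1 + s) / 2) / (√π * (s / 2 * Gamma (s / 2)))) =
      2 / (1 - s) * (Gamma ((1 + s) / 2) / (√π * Gamma (s / 2))) := by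
    rw [div_mul_div_comm, div_mul_div_comm, ← mul_div_mul_left (2 * _) _ hs.ne',
      ← mul_div_mul_left (s * _) _ two_ne_zero]
    congr 1 <;> ring
  rw [this]
  ring

lemma abs_circle_coeff_le {s : ℝ} (hs0 : 0 < s) (hs2 : s < 2) :
    |2 / π * ((2 - s) / (1 - s) * wallisIntegral (2 - s))| ≤ 2 / |1 - s| := by
  have h1 := wallisIntegral_le (p := 2 - s) (by linarith)
  have h0 := wallisIntegral_nonneg (2 - s)
  rw [abs_mul, abs_mul, abs_div (2 - s), abs_of_nonneg h0, abs_of_pos (by positivity : 0 < 2 / π),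
    abs_of_pos (by linarith : 0 < 2 - s), div_mul_eq_mul_div (2 - s),
    ← mul_div_assoc (2 / π)]
  refine div_le_div_of_nonneg_right ?_ (abs_nonneg _)
  calc 2 / π * ((2 - s) * wallisIntegral (2 - s)) ≤ 2 / π * (2 * (π / 2)) := by gcongr; linarith
    _ = 2 := by field_simp

lemma abs_line_coeff_le {s : ℝ} (hs0 : 0 < s) :
    |s / (1 - s) * (2 / π * wallisIntegral s)| ≤ s / |1 - s| := by
  have h1 := wallisIntegral_le hs0.le
  have h0 := wallisIntegral_nonneg s
  rw [abs_mul, abs_div, abs_of_pos hs0, abs_of_nonneg (by positivity : 0 ≤ 2 / π * _)]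
  refine mul_le_of_le_one_right (by positivity) ?_
  calc 2 / π * wallisIntegral s ≤ 2 / π * (π / 2) := by gcongr
    _ = 1 := by field_simp

/-! ### Expansion of l in the shift R -/

section Shifted

variable {M R x y : ℝ}

lemma two_mul_le_two_mul_sqrt (hR : 0 < R) (hx : 0 ≤ x) (hy : 0 ≤ y) :
    2 * R ≤ 2 * √((R + x) * (R + y)) := by
  have : R ≤ √((R + x) * (R + y)) := le_sqrt_of_sq_le (by nlinarith [mul_nonneg hx hy])
  linarith

lemma two_mul_sqrt_le (hR : 0 < R) (hx : 0 ≤ x) (hy : 0 ≤ y) :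
    2 * √((R + x) * (R + y)) ≤ 2 * R + (x + y) := by
  have : √((R + x) * (R + y)) ≤ R + (x + y) / 2 :=
    sqrt_le_iff.2 ⟨by positivity, by nlinarith [sq_nonneg (x - y)]⟩
  linarith

lemma abs_two_mul_sqrt_rpow_sub_le {s : ℝ} (hs0 : 0 < s) (hs2 : s < 2) (hM : 1 ≤ M) (hR : 1 ≤ R)
    (hx : 0 ≤ x) (hy : 0 ≤ y) (hxM : x ≤ M) (hyM : y ≤ M) :
    |(2 * √((R + x) * (R + y))) ^ (-s) - (2 * R) ^ (-s) * (1 - s * ((x + y) / (2 * R)))| ≤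
      5 * M ^ 4 * (s / R ^ 2) := by
  have hR0 : 0 < R := by linarith
  -- Chosen so that (1 + x/R)(1 + y/R) = 1 + u; its linear part gives the Re[z - w_*] term and xy/R²
  -- goes into the error.
  set u := (x + y) / R + x * y / R ^ 2 with hu
  have hu0 : 0 ≤ u := by positivity
  have e : (2 * √((R + x) * (R + y))) ^ (-s) = (2 * R) ^ (-s) * (1 + u) ^ (-(s / 2)) := by
    rw [← sq_rpow_neg_half (by positivity), ← sq_rpow_neg_half (by positivity : 0 ≤ 2 * R),
      ← neg_div, ← mul_rpow (by positivity) (by positivity), mul_pow, sq_sqrt (by positivity), hu]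
    congr 1
    field_simp
    ring
  have h1 := one_sub_mul_le_one_add_rpow_neg (p := s / 2) (by linarith) (by linarith) hu0
  have h2 := one_add_rpow_neg_le (p := s / 2) (by linarith) (by linarith) hu0
  have hle : (2 * R) ^ (-s) ≤ 1 :=
    rpow_le_one_of_one_le_of_nonpos (by linarith) (by linarith)
  have hle0 : 0 ≤ (2 * R) ^ (-s) := by positivity
  have hxy : x * y ≤ M ^ 2 := by nlinarith
  have hu1 : u ≤ 3 * M ^ 2 / R := by
    have : x * y / R ^ 2 ≤ M ^ 2 / R := by
      gcongr
      nlinarith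
    have : (x + y) / R ≤ 2 * M ^ 2 / R := by
      gcongr
      nlinarith
    have : 3 * M ^ 2 / R = 2 * M ^ 2 / R + M ^ 2 / R := by ring
    linarith
  have hu2 : u ^ 2 ≤ 9 * M ^ 4 / R ^ 2 := by
    calc u ^ 2 ≤ (3 * M ^ 2 / R) ^ 2 := by gcongr
      _ = _ := by ring
  have hxyM : x * y / R ^ 2 ≤ M ^ 4 / R ^ 2 := by
    gcongr
    exact hxy.trans (pow_le_pow_right₀ hM (by norm_num))
  have hxy0 : 0 ≤ x * y / R ^ 2 := by positivity
  have hlin : s * ((x + y) / (2 * R)) = s / 2 * (u - x * y / R ^ 2) := by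
    rw [hu]; field_simp; ring
  have hfin : 5 * M ^ 4 * (s / R ^ 2) = s / 2 * (9 * M ^ 4 / R ^ 2 + M ^ 4 / R ^ 2) := by ring
  rw [e, ← mul_sub, abs_mul, abs_of_nonneg hle0, hlin, hfin]
  refine (mul_le_of_le_one_left (abs_nonneg _) hle).trans ?_
  rw [abs_le]
  constructor <;> nlinarith

lemma abs_one_div_two_mul_sqrt_sub_le (hR : 0 < R) (hx : 0 ≤ x) (hy : 0 ≤ y)
    (hxM : x ≤ M) (hyM : y ≤ M) :
    |1 / (2 * √((R + x) * (R + y))) - 1 / (2 * R)| ≤ M / R ^ 2 := by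
  have h1 := two_mul_le_two_mul_sqrt hR hx hy
  have h2 := two_mul_sqrt_le hR hx hy
  generalize 2 * √((R + x) * (R + y)) = l at *
  have hl : 0 < l := by linarith
  rw [div_sub_div _ _ hl.ne' (by positivity), abs_div, abs_of_pos (by positivity : 0 < l * (2 * R)),
    abs_of_nonpos (by linarith), div_le_div_iff₀ (by positivity) (by positivity)]
  have h3 : -(1 * (2 * R) - l * 1) ≤ 2 * M := by linarith
  have hM : 0 ≤ M := by linarith
  have h4 : M * (2 * R * (2 * R)) ≤ M * (l * (2 * R)) := by gcongr
  nlinarith [sq_nonneg R, mul_le_mul_of_nonneg_right h3 (sq_nonneg R), mul_nonneg hM (sq_nonneg R)]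

end Shifted

/-! ### Expansion of the kernel -/

/-- Multiplying the expansion of the angular integral by l^{-s} cancels the s-dependence of the
powers of l in all but the leading term. -/
lemma abs_rieszKernel_sub_le {s : ℝ} {z w : ℂ} (hz : 0 < z.re) (hw : 0 < w.re)
    (hs0 : 0 < s) (hs2 : s < 2) (hs1 : s ≠ 1) (h : z ≠ w ∨ s < 1)
    (hle : ‖z - w‖ ≤ 2 * √(z.re * w.re)) :
    |rieszKernel s z w -
      (2 / π * ((2 - s) / (1 - s) * wallisIntegral (2 - s)) * (2 * √(z.re * w.re)) ^ (-s) -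
        s / (1 - s) * (2 / π * wallisIntegral s) *
          (‖z - w‖ ^ (1 - s) * (1 / (2 * √(z.re * w.re)))))| ≤
      (2 + 2 / |1 - s|) * ‖z - w‖ ^ (2 - s) * (s / (2 * √(z.re * w.re)) ^ 2) := by
  rw [rieszKernel_eq hz hw h]
  have hzw : 0 < z.re * w.re := mul_pos hz hw
  set l := 2 * √(z.re * w.re) with hl
  have hl0 : 0 < l := by positivity
  have hr := norm_nonneg (z - w)
  have hmain := abs_angularIntegral_sub_le hs0 hs2 hs1 (div_nonneg hr hl0.le)
    ((div_le_one hl0).2 hle)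
    (h.imp_left fun h => div_pos (norm_pos_iff.2 (sub_ne_zero.2 h)) hl0)
  have e1 : l ^ (-s) * (‖z - w‖ / l) ^ (1 - s) = ‖z - w‖ ^ (1 - s) * (1 / l) := by
    rw [div_rpow hr hl0.le, rpow_sub hl0, rpow_neg hl0.le, rpow_one]
    field_simp
  have e2 : l ^ (-s) * (‖z - w‖ / l) ^ (2 - s) = ‖z - w‖ ^ (2 - s) / l ^ 2 := by
    rw [div_rpow hr hl0.le, rpow_sub hl0, rpow_neg hl0.le, rpow_two]
    field_simp
  generalize angularIntegral s (‖z - w‖ / l) = J at *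
  have e : 2 / π * (l ^ (-s) * J) -
      (2 / π * ((2 - s) / (1 - s) * wallisIntegral (2 - s)) * l ^ (-s) -
        s / (1 - s) * (2 / π * wallisIntegral s) * (‖z - w‖ ^ (1 - s) * (1 / l))) =
      2 / π * (l ^ (-s) * (J - ((2 - s) / (1 - s) * wallisIntegral (2 - s) -
        s / (1 - s) * wallisIntegral s * (‖z - w‖ / l) ^ (1 - s)))) := by
    rw [← e1]; ring
  have hpi : 2 / π ≤ 1 := (div_le_one pi_pos).2 two_le_pi
  have hl' : 0 < l ^ (-s) := by positivity
  rw [e, abs_mul, abs_mul, abs_of_pos (by positivity : 0 < 2 / π), abs_of_pos hl']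
  refine (mul_le_of_le_one_left (by positivity) hpi).trans ?_
  refine (mul_le_mul_of_nonneg_left hmain hl'.le).trans_eq ?_
  linear_combination (2 + 2 / |1 - s|) * s * e2

lemma rpow_two_sub_le {s r : ℝ} (hs0 : 0 < s) (hs2 : s < 2) (hr : 0 ≤ r) :
    r ^ (2 - s) ≤ (1 + r) ^ 2 := by
  calc r ^ (2 - s) ≤ (1 + r) ^ (2 - s) := rpow_le_rpow hr (by linarith) (by linarith)
    _ ≤ (1 + r) ^ (2 : ℝ) := rpow_le_rpow_of_exponent_le (by linarith) (by linarith)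
    _ = _ := rpow_two _

/-- The expansion of the kernel with an explicit remainder. -/
theorem abs_rieszKernel_shift_sub_le {s R M : ℝ} {z w : ℂ} (hz : z ∈ closedRightHalfPlane)
    (hw : w ∈ closedRightHalfPlane) (hzM : z.re ≤ M) (hwM : w.re ≤ M) (hM : 1 ≤ M)
    (hs0 : 0 < s) (hs2 : s < 2) (hs1 : s ≠ 1) (h : z ≠ w ∨ s < 1) (hR : 1 ≤ R)
    (hle : ‖z - w‖ ≤ 2 * R) :
    |rieszKernel s ((R : ℂ) + z) ((R : ℂ) + w) -
        (circleEnergy s * R ^ (-s)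
          - s / (1 - s) * (Gamma ((1 + s) / 2) / (√π * Gamma (1 + s / 2))) *
              (‖z - w‖ ^ (1 - s) / (2 * R))
          - s * circleEnergy s * ((z - reflectIm w).re / (2 * R)) * R ^ (-s))| ≤
      ((2 + 2 / |1 - s|) * (1 + ‖z - w‖) ^ 2 +
        (10 * M ^ 4 + ‖z - w‖ ^ (1 - s) * M) / |1 - s|) * (s / R ^ 2) := by
  change 0 ≤ z.re at hz
  change 0 ≤ w.re at hw
  have hR0 : 0 < R := by linarith
  have hne : 0 < |1 - s| := abs_pos.2 (sub_ne_zero.2 hs1.symm)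
  have hl1 := two_mul_le_two_mul_sqrt hR0 hz hw
  have hsub : (R : ℂ) + z - (R + w) = z - w := by ring
  have h1 := abs_rieszKernel_sub_le (s := s) (z := R + z) (w := R + w) (by simp; linarith)
    (by simp; linarith) hs0 hs2 hs1 (h.imp_left fun h => by simpa using h)
    (by rw [hsub]; simpa using hle.trans hl1)
  have h2 := abs_two_mul_sqrt_rpow_sub_le hs0 hs2 hM hR hz hw hzM hwM
  have h3 := abs_one_div_two_mul_sqrt_sub_le hR0 hz hw hzM hwM
  have hA := abs_circle_coeff_le hs0 hs2
  have hB := abs_line_coeff_le hs0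
  simp only [hsub, Complex.add_re, Complex.ofReal_re] at h1
  have e0 : (2 * R) ^ (-s) = 2 ^ (-s) * R ^ (-s) := mul_rpow (by norm_num) hR0.le
  have eσ : (z - reflectIm w).re = z.re + w.re := by simp [reflectIm]
  rw [gamma_div_gamma_eq_wallisIntegral hs0, circleEnergy_eq hs2 hs1, eσ]
  rw [e0] at h2
  have hρ := norm_nonneg (z - w)
  have hρ2 := rpow_two_sub_le hs0 hs2 hρ
  have hρ1 : 0 ≤ ‖z - w‖ ^ (1 - s) := by positivity
  generalize 2 / π * ((2 - s) / (1 - s) * wallisIntegral (2 - s)) = A at *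
  generalize s / (1 - s) * (2 / π * wallisIntegral s) = B at *
  generalize 2 * √((R + z.re) * (R + w.re)) = l at *
  generalize rieszKernel s (↑R + z) (↑R + w) = K at *
  generalize ‖z - w‖ ^ (1 - s) = p at *
  generalize ‖z - w‖ ^ (2 - s) = q at *
  have hl : 0 < l := by linarith
  -- Three errors: the angular expansion, l^{-s} against its linearization, and 1/l against 1/(2R).
  have e : K - (2 ^ (-s) * A * R ^ (-s) - B * (p / (2 * R)) -
      s * (2 ^ (-s) * A) * ((z.re + w.re) / (2 * R)) * R ^ (-s)) =
      (K - (A * l ^ (-s) - B * (p * (1 / l)))) +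
      (A * (l ^ (-s) - 2 ^ (-s) * R ^ (-s) * (1 - s * ((z.re + w.re) / (2 * R)))) -
      B * (p * (1 / l - 1 / (2 * R)))) := by ring
  rw [e]
  refine (abs_add_le _ _).trans ((add_le_add le_rfl (abs_sub _ _)).trans ?_)
  rw [abs_mul, abs_mul, abs_mul, abs_of_nonneg hρ1]
  have c1 : (2 + 2 / |1 - s|) * q * (s / l ^ 2) ≤
      (2 + 2 / |1 - s|) * (1 + ‖z - w‖) ^ 2 * (s / R ^ 2) := by
    gcongr
    linarith
  have c2 : |A| * |l ^ (-s) - 2 ^ (-s) * R ^ (-s) * (1 - s * ((z.re + w.re) / (2 * R)))| ≤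
      2 / |1 - s| * (5 * M ^ 4 * (s / R ^ 2)) := by gcongr
  have c3 : |B| * (p * |1 / l - 1 / (2 * R)|) ≤ s / |1 - s| * (p * (M / R ^ 2)) := by gcongr
  have e2 : ((2 + 2 / |1 - s|) * (1 + ‖z - w‖) ^ 2 + (10 * M ^ 4 + p * M) / |1 - s|) *
      (s / R ^ 2) = (2 + 2 / |1 - s|) * (1 + ‖z - w‖) ^ 2 * (s / R ^ 2) +
      (2 / |1 - s| * (5 * M ^ 4 * (s / R ^ 2)) + s / |1 - s| * (p * (M / R ^ 2))) := by ring
  rw [e2]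
  linarith

/-- Supplies a constant independent of s. At r = 0 both sides vanish, since 1/0 = 0. -/
lemma rpow_one_sub_le {s r : ℝ} (hs0 : 0 < s) (hs2 : s < 2) (hs1 : s ≠ 1) (hr : 0 ≤ r) :
    r ^ (1 - s) ≤ r + 1 / r := by
  rcases hr.eq_or_lt with rfl | hr
  · simp [zero_rpow (sub_ne_zero.2 hs1.symm)]
  · have h0 : 0 < 1 / r := by positivity
    rcases le_total 1 r with h1 | h1
    · have := rpow_le_rpow_of_exponent_le h1 (by linarith : 1 - s ≤ 1)
      rw [rpow_one] at this
      linarith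
    · have := rpow_le_rpow_of_exponent_ge hr h1 (by linarith : -1 ≤ 1 - s)
      rw [rpow_neg_one, ← one_div] at this
      linarith

/-- The deviation of the rescaled kernel from its limit for `s > 1`. -/
theorem abs_rpow_mul_rescaledKernel_sub_le {s R M : ℝ} {z w : ℂ} (hz : z ∈ closedRightHalfPlane)
    (hw : w ∈ closedRightHalfPlane) (hzM : z.re ≤ M) (hwM : w.re ≤ M)
    (hρM : ‖z - w‖ ≤ 2 * M) (hM : 0 < M) (hs : 1 < s) (hzw : z ≠ w) (hR : M ≤ R) :
    |‖z - w‖ ^ (s - 1) * rescaledKernel s R z w - ‖z - w‖ ^ (s - 1) * limitKernel s z w| ≤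
      (2 + (1 + s) / (s - 1)) * (M / R + (M / R) ^ (s - 1)) +
        s / (s - 1) * wallisIntegral s * (2 * (M / R)) := by
  change 0 ≤ z.re at hz
  change 0 ≤ w.re at hw
  have hs0 : 0 < s := by linarith
  have hs1 : 0 < s - 1 := by linarith
  have hR0 : 0 < R := by linarith
  have hρ : 0 < ‖z - w‖ := norm_pos_iff.2 (sub_ne_zero.2 hzw)
  have hl1 := two_mul_le_two_mul_sqrt hR0 hz hw
  have h3 := abs_one_div_two_mul_sqrt_sub_le hR0 hz hw hzM hwM
  have hsub : (R : ℂ) + z - (R + w) = z - w := by ring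
  rw [rescaledKernel, if_neg (not_lt.2 hs.le), rieszKernel_eq (by simp; linarith)
    (by simp; linarith) (Or.inl (by simpa using hzw)), limitKernel_eq hs0, hsub]
  simp only [Complex.add_re, Complex.ofReal_re]
  generalize 2 * √((R + z.re) * (R + w.re)) = l at *
  have hl : 0 < l := by linarith
  have hε0 : 0 < ‖z - w‖ / l := by positivity
  have hεM : ‖z - w‖ / l ≤ M / R := by
    rw [div_le_div_iff₀ hl hR0]
    nlinarith
  have hε1 : ‖z - w‖ / l ≤ 1 := hεM.trans ((div_le_one hR0).2 hR)
  have hmain := abs_rpow_mul_angularIntegral_sub_le hs hε0 hε1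
  have hεs : (‖z - w‖ / l) ^ (s - 1) ≤ (M / R) ^ (s - 1) := rpow_le_rpow hε0.le hεM hs1.le
  have e1 : ‖z - w‖ ^ (s - 1) * l ^ (-s) = (‖z - w‖ / l) ^ (s - 1) * (1 / l) := by
    rw [div_rpow hρ.le hl.le, rpow_sub_one hl.ne', rpow_neg hl.le]
    field_simp
  have e2 : ‖z - w‖ ^ (s - 1) * ‖z - w‖ ^ (1 - s) = 1 := by rw [← rpow_add hρ]; simp
  have hW := wallisIntegral_nonneg s
  have hL : 0 ≤ s / (s - 1) * wallisIntegral s := by positivity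
  have e3 : s / (1 - s) = -(s / (s - 1)) := by rw [← div_neg, neg_sub]
  rw [e3]
  generalize angularIntegral s (‖z - w‖ / l) = J at *
  -- Two errors remain: the scaled angular integral against its limit, and 2R/l against 1.
  have e : ‖z - w‖ ^ (s - 1) * (2 * R * (2 / π * (l ^ (-s) * J))) -
      ‖z - w‖ ^ (s - 1) * (-(-(s / (s - 1)) * (2 / π * wallisIntegral s) * ‖z - w‖ ^ (1 - s))) =
      2 / π * (2 * R * (1 / l) * ((‖z - w‖ / l) ^ (s - 1) * J - s / (s - 1) * wallisIntegral s) +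
        s / (s - 1) * wallisIntegral s * (2 * R * (1 / l - 1 / (2 * R)))) := by
    have : 2 * R * (1 / (2 * R)) = 1 := by field_simp
    linear_combination 2 * R * (2 / π) * J * e1 - s / (s - 1) * (2 / π * wallisIntegral s) * e2
      + 2 / π * (s / (s - 1)) * wallisIntegral s * this
  generalize s / (s - 1) * wallisIntegral s = L at *
  have hpi : 2 / π ≤ 1 := (div_le_one pi_pos).2 two_le_pi
  have hRl : 2 * R * (1 / l) ≤ 1 := by rw [mul_one_div]; exact (div_le_one hl).2 hl1
  rw [e, abs_mul, abs_of_pos (by positivity : 0 < 2 / π)]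
  refine (mul_le_of_le_one_left (abs_nonneg _) hpi).trans ((abs_add_le _ _).trans ?_)
  rw [abs_mul, abs_mul L, abs_mul (2 * R) (1 / l - _), abs_of_nonneg hL,
    abs_of_pos (by positivity : 0 < 2 * R * (1 / l)), abs_of_pos (by positivity : 0 < 2 * R)]
  refine add_le_add ?_ ?_
  · refine (mul_le_of_le_one_left (abs_nonneg _) hRl).trans (hmain.trans ?_)
    have : 0 ≤ (1 + s) / (s - 1) := by positivity
    gcongr
  · refine mul_le_mul_of_nonneg_left ?_ hL
    calc 2 * R * |1 / l - 1 / (2 * R)| ≤ 2 * R * (M / R ^ 2) := by gcongr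
      _ = 2 * (M / R) := by field_simp

/-! ### Uniform convergence and the uniform expansion -/

lemma exists_norm_bound {A : Set (ℂ × ℂ)} (hA : IsCompact A) :
    ∃ M : ℝ, 1 ≤ M ∧ ∀ p ∈ A, p.1.re ≤ M ∧ p.2.re ≤ M ∧ ‖p.1 - p.2‖ ≤ 2 * M := by
  obtain ⟨M, hM⟩ := hA.isBounded.exists_norm_le
  refine ⟨max 1 M, le_max_left _ _, fun p hp => ?_⟩
  have h := hM p hp
  rw [Prod.norm_def] at h
  have h1 := (le_max_left _ _).trans (h.trans (le_max_right 1 M))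
  have h2 := (le_max_right _ _).trans (h.trans (le_max_right 1 M))
  exact ⟨(Complex.re_le_norm _).trans h1, (Complex.re_le_norm _).trans h2,
    (norm_sub_le _ _).trans (by linarith)⟩

lemma tendstoUniformlyOn_of_abs_sub_le {X : Type*} {F : ℝ → X → ℝ} {f : X → ℝ} {S : Set X}
    {b : ℝ → ℝ} {R₀ : ℝ} (hb : Filter.Tendsto b Filter.atTop (nhds 0))
    (h : ∀ R, R₀ ≤ R → ∀ p ∈ S, |F R p - f p| ≤ b R) :
    TendstoUniformlyOn F f Filter.atTop S := by
  rw [Metric.tendstoUniformlyOn_iff]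
  intro ε hε
  filter_upwards [hb.eventually_lt_const hε, Filter.eventually_ge_atTop R₀] with R h1 h2 p hp
  rw [dist_comm, Real.dist_eq]
  exact (h R h2 p hp).trans_lt h1

theorem tendstoUniformlyOn_rescaledKernel {s : ℝ} (hs0 : 0 < s) (hs1 : s < 1) {A : Set (ℂ × ℂ)}
    (hAH : A ⊆ closedRightHalfPlane ×ˢ closedRightHalfPlane) (hA : IsCompact A) :
    TendstoUniformlyOn (fun (R : ℝ) (p : ℂ × ℂ) => rescaledKernel s R p.1 p.2)
      (fun p : ℂ × ℂ => limitKernel s p.1 p.2) Filter.atTop A := by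
  obtain ⟨M, hM, hbound⟩ := exists_norm_bound hA
  have hne : 0 < |1 - s| := abs_pos.2 (by linarith)
  set C := (2 + 2 / |1 - s|) * (1 + 2 * M) ^ 2 + (10 * M ^ 4 + (2 * M) ^ (1 - s) * M) / |1 - s|
  refine tendstoUniformlyOn_of_abs_sub_le (R₀ := M)
    -- The first summand is 2R times the O(s/R²) error, the second 2R times the Re[z - w_*] term.
    (b := fun R => 2 * C * s * R⁻¹ + s * |circleEnergy s| * (2 * M) * R ^ (-s)) ?_ ?_
  · simpa using (tendsto_inv_atTop_zero.const_mul (2 * C * s)).add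
      ((tendsto_rpow_neg_atTop hs0).const_mul (s * |circleEnergy s| * (2 * M)))
  rintro R hMR ⟨z, w⟩ hp
  obtain ⟨hz, hw⟩ := hAH hp
  obtain ⟨hzM, hwM, hρM⟩ := hbound _ hp
  simp only at hz hw hzM hwM hρM ⊢
  have hR0 : 0 < R := by linarith
  have hρ := norm_nonneg (z - w)
  have h := abs_rieszKernel_shift_sub_le hz hw hzM hwM hM hs0 (by linarith) hs1.ne (Or.inr hs1)
    (hM.trans hMR) (by linarith)
  have hC : ((2 + 2 / |1 - s|) * (1 + ‖z - w‖) ^ 2 +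
      (10 * M ^ 4 + ‖z - w‖ ^ (1 - s) * M) / |1 - s|) * (s / R ^ 2) ≤ C * (s / R ^ 2) := by
    have : ‖z - w‖ ^ (1 - s) ≤ (2 * M) ^ (1 - s) := rpow_le_rpow hρ hρM (by linarith)
    simp only [C]
    gcongr
  replace h := h.trans hC
  have eσ : (z - reflectIm w).re = z.re + w.re := by simp [reflectIm]
  rw [gamma_div_gamma_eq_wallisIntegral hs0, eσ] at h
  rw [rescaledKernel, if_pos hs1, limitKernel_eq hs0]
  generalize s / (1 - s) * (2 / π * wallisIntegral s) = B at *
  generalize rieszKernel s (↑R + z) (↑R + w) = K at *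
  generalize ‖z - w‖ ^ (1 - s) = p at *
  have e : 2 * R * (K - circleEnergy s * R ^ (-s)) - -(B * p) =
      2 * R * (K - (circleEnergy s * R ^ (-s) - B * (p / (2 * R)) -
        s * circleEnergy s * ((z.re + w.re) / (2 * R)) * R ^ (-s))) -
      s * circleEnergy s * ((z.re + w.re) * R ^ (-s)) := by
    field_simp
    ring
  have hσ : 0 ≤ z.re + w.re := add_nonneg hz hw
  rw [e]
  refine (abs_sub _ _).trans ?_
  rw [abs_mul, abs_mul (s * _), abs_mul s, abs_of_pos hs0, abs_of_pos (by positivity : 0 < 2 * R),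
    abs_of_nonneg (by positivity : 0 ≤ (z.re + w.re) * R ^ (-s)), mul_assoc _ (2 * M)]
  refine add_le_add ?_ ?_
  · calc _ ≤ 2 * R * (C * (s / R ^ 2)) := by gcongr
      _ = _ := by field_simp
  · gcongr
    linarith

theorem tendstoUniformlyOn_rpow_mul_rescaledKernel {s : ℝ} (hs : 1 < s) {A : Set (ℂ × ℂ)}
    (hAH : A ⊆ closedRightHalfPlane ×ˢ closedRightHalfPlane) (hA : IsCompact A) :
    TendstoUniformlyOn
      (fun (R : ℝ) (p : ℂ × ℂ) => ‖p.1 - p.2‖ ^ (s - 1) * rescaledKernel s R p.1 p.2)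
      (fun p : ℂ × ℂ => ‖p.1 - p.2‖ ^ (s - 1) * limitKernel s p.1 p.2)
      Filter.atTop {p ∈ A | p.1 ≠ p.2} := by
  obtain ⟨M, hM, hbound⟩ := exists_norm_bound hA
  refine tendstoUniformlyOn_of_abs_sub_le (R₀ := M)
    (b := fun R => (2 + (1 + s) / (s - 1)) * (M / R + (M / R) ^ (s - 1)) +
        s / (s - 1) * wallisIntegral s * (2 * (M / R))) ?_ ?_
  · have h1 : Filter.Tendsto (fun R : ℝ => M / R) Filter.atTop (nhds 0) :=
      tendsto_const_nhds.div_atTop Filter.tendsto_id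
    have h2 := h1.rpow_const (p := s - 1) (Or.inr (by linarith))
    rw [zero_rpow (by linarith)] at h2
    simpa using ((h1.add h2).const_mul _).add ((h1.const_mul 2).const_mul _)
  · rintro R hMR ⟨z, w⟩ ⟨hp, hzw⟩
    obtain ⟨hz, hw⟩ := hAH hp
    obtain ⟨hzM, hwM, hρM⟩ := hbound _ hp
    exact abs_rpow_mul_rescaledKernel_sub_le hz hw hzM hwM hρM (by linarith) hs hzw hMR

theorem lemma4p1 :
    -- the expansion, with an error `O(s / R²)` that is uniform in `s` away from `s = 1`
    (∀ z ∈ closedRightHalfPlane, ∀ w ∈ closedRightHalfPlane, ∀ δ : ℝ, 0 < δ →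
      ∃ C R₀ : ℝ, 0 < R₀ ∧ ∀ s : ℝ, 0 < s → s < 2 → s ≠ 1 → δ ≤ |s - 1| → (z ≠ w ∨ s < 1) →
        ∀ R : ℝ, R₀ ≤ R →
          |rieszKernel s ((R : ℂ) + z) ((R : ℂ) + w) -
            (circleEnergy s * R ^ (-s)
              - s / (1 - s) *
                  (Real.Gamma ((1 + s) / 2) / (Real.sqrt Real.pi * Real.Gamma (1 + s / 2))) *
                  (‖z - w‖ ^ (1 - s) / (2 * R))
              - (2 : ℝ) ^ (-s) *
                  (s * Real.Gamma ((1 - s) / 2) / (Real.sqrt Real.pi * Real.Gamma (1 - s / 2))) *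
                  ((z - reflectIm w).re / (2 * R)) * R ^ (-s))|
            ≤ C * (s / R ^ 2)) ∧
    -- convergence of the rescaled kernels, `0 < s < 1`
    (∀ s : ℝ, 0 < s → s < 1 →
      ∀ A : Set (ℂ × ℂ), A ⊆ closedRightHalfPlane ×ˢ closedRightHalfPlane → IsCompact A →
        TendstoUniformlyOn (fun (R : ℝ) (p : ℂ × ℂ) => rescaledKernel s R p.1 p.2)
          (fun p : ℂ × ℂ => limitKernel s p.1 p.2) Filter.atTop A) ∧
    -- convergence of the rescaled kernels, `s > 1`
    (∀ s : ℝ, 1 < s →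
      ∀ A : Set (ℂ × ℂ), A ⊆ closedRightHalfPlane ×ˢ closedRightHalfPlane → IsCompact A →
        TendstoUniformlyOn
          (fun (R : ℝ) (p : ℂ × ℂ) => ‖p.1 - p.2‖ ^ (s - 1) * rescaledKernel s R p.1 p.2)
          (fun p : ℂ × ℂ => ‖p.1 - p.2‖ ^ (s - 1) * limitKernel s p.1 p.2)
          Filter.atTop {p ∈ A | p.1 ≠ p.2}) := by
  refine ⟨fun z hz w hw δ hδ => ?_,
    fun s hs0 hs1 A hAH hA => tendstoUniformlyOn_rescaledKernel hs0 hs1 hAH hA,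
    fun s hs A hAH hA => tendstoUniformlyOn_rpow_mul_rescaledKernel hs hAH hA⟩
  set M := max 1 (max z.re w.re)
  have hM : 1 ≤ M := le_max_left _ _
  have hρ := norm_nonneg (z - w)
  -- The pointwise constant with δ for |1-s| and r + 1/r for r^{1-s}, r = |z - w|. The threshold
  -- ensures R ≥ 1 and |z - w| ≤ 2R.
  refine ⟨(2 + 2 / δ) * (1 + ‖z - w‖) ^ 2 +
    (10 * M ^ 4 + (‖z - w‖ + 1 / ‖z - w‖) * M) / δ, 1 + ‖z - w‖, by positivity, ?_⟩
  intro s hs0 hs2 hs1 hδs h R hR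
  rw [abs_sub_comm] at hδs
  have hp := rpow_one_sub_le hs0 hs2 hs1 hρ
  have key := abs_rieszKernel_shift_sub_le hz hw ((le_max_left _ _).trans (le_max_right _ _))
    ((le_max_right _ _).trans (le_max_right _ _)) hM hs0 hs2 hs1 h (R := R) (by linarith)
    (by linarith)
  have e : (2 : ℝ) ^ (-s) * (s * Gamma ((1 - s) / 2) / (√π * Gamma (1 - s / 2))) =
      s * circleEnergy s := by
    rw [circleEnergy]; ring
  rw [e]
  refine key.trans ?_
  gcongr
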